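/- Let $E$ be a finite-dimensional operator space: an $n$-dimensional complex normed space $V$ with a fixed basis $e_1,\dots,e_n$ (so $V\cong\mathbb C^n$) and an isometric linear map $\varphi:V\to B(H)$, $H$ a Hilbert space, where $M_{k,l}(E)$ carries the norm $\|(x_{ij})\|=\|(\varphi(x_{ij}))\|_{B(H^l,H^k)}$. For an $n$-tuple $S=(S_1,\dots,S_n)$ of bounded operators on a Hilbert space $K$ put $\sigma_S(\sum_j z_je_j)=\sum_j z_jS_j$; it is completely contractive for $E$ if $\|(\sigma_S(x_{ij}))\|_{B(K^l,K^k)}\le\|(x_{ij})\|_{M_{k,l}(E)}$ for all $k,l$ and all matrices $(x_{ij})$ over $V$. For an $m\times m$ matrix-valued polynomial $p(z)=\sum_{\mathbf d}A_{\mathbf d}z^{\mathbf d}$ in $n$ variables and commuting $S$ put $p(S)=\sum_{\mathbf d}A_{\mathbf d}\otimes S^{\mathbf d}$, an operator on $\mathbb C^m\otimes K$, and let $$\|p\|_{UC(E)}=\sup_S\|p(S)\|,$$ the supremum over all commuting $n$-tuples $S$ of bounded operators on Hilbert spaces for which $\sigma_S$ is completely contractive for $E$. Finally, for an $n$-tuple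 $S$ of $d\times d$ matrices let $$\|S\|_{M_d(E^*)}=\sup\Big\{\Big\|\sum_{j=1}^n S_j\otimes B_j\Big\| : l\ge 1,\ B=(B_1,\dots,B_n)\in M_l(E),\ \|B\|_{M_l(E)}\le1\Big\},$$ where the element $(x_{pq})$ of $M_l(E)$ is written as the tuple $B$ of the $l\times l$ matrices of its coordinates, $x_{pq}=\sum_j (B_j)_{pq}e_j$. **Theorem.** For every $m$ and every $m\times m$ matrix-valued polynomial $p$, the supremum $\|p\|_{UC(E)}$ is finite and $$\|p\|_{UC(E)}=\sup\|p(S)\|,$$ where the supremum is taken only over the $n$-tuples $S$ of commuting matrices (of any common size $d\times d$) for which $\sigma_S$ is completely contractive for $E$. Moreover, an $n$-tuple $S$ of $d\times d$ matrices has this last property if and only if $\|S\|_{M_d(E^*)}\le1$, so the supremum may equally be taken over the commuting tuples of matrices in the unit ball of $E^*$. -/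

import Mathlib

universe u v w

open scoped ENNReal Kronecker

noncomputable section

namespace UC

/-- The bounded operator `K^l → K^k` (Hilbert space direct sums) given by a `k × l` matrix of bounded
operators on `K`, i.e. the identification of `M_{k,l}(B(K))` with `B(K^l, K^k)`. -/
def blockOp {K : Type*} [NormedAddCommGroup K] [InnerProductSpace ℂ K] {k l : ℕ}
    (M : Matrix (Fin k) (Fin l) (K →L[ℂ] K)) :
    PiLp 2 (fun _ : Fin l => K) →L[ℂ] PiLp 2 (fun _ : Fin k => K) :=
  (PiLp.continuousLinearEquiv 2 ℂ (fun _ : Fin k => K)).symm.toContinuousLinearMap ∘L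
    ContinuousLinearMap.pi fun i => ∑ j, M i j ∘L PiLp.proj 2 (fun _ : Fin l => K) j

theorem blockOp_apply {K : Type*} [NormedAddCommGroup K] [InnerProductSpace ℂ K] {k l : ℕ}
    (M : Matrix (Fin k) (Fin l) (K →L[ℂ] K)) (x : PiLp 2 (fun _ : Fin l => K)) (i : Fin k) :
    blockOp M x i = ∑ j, M i j (x j) := by
  simp [blockOp]

/-- The norm on `M_{k,l}(E)`, where the operator space `E` is the normed space `V` with the operator
space structure given by an isometric linear map `φ : V → B(H)`. -/
def matrixNorm {V : Type*} [NormedAddCommGroup V] [NormedSpace ℂ V]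
    {H : Type*} [NormedAddCommGroup H] [InnerProductSpace ℂ H]
    (φ : V →ₗᵢ[ℂ] (H →L[ℂ] H)) {k l : ℕ} (x : Matrix (Fin k) (Fin l) V) : ℝ :=
  ‖blockOp (x.map φ)‖

/-- `ψ : V → B(K)` is completely contractive for the operator space `E = (V, φ)`. -/
def IsCompletelyContractive {V : Type*} [NormedAddCommGroup V] [NormedSpace ℂ V]
    {H : Type*} [NormedAddCommGroup H] [InnerProductSpace ℂ H]
    {K : Type*} [NormedAddCommGroup K] [InnerProductSpace ℂ K]
    (φ : V →ₗᵢ[ℂ] (H →L[ℂ] H)) (ψ : V →ₗ[ℂ] (K →L[ℂ] K)) : Prop :=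
  ∀ (k l : ℕ) (x : Matrix (Fin k) (Fin l) V), ‖blockOp (x.map ψ)‖ ≤ matrixNorm φ x

/-- The linear map `σ_S : V → B(K)`, `∑ j, z_j e_j ↦ ∑ j, z_j S_j`, of an `n`-tuple `S` of operators,
where `e = b` is the chosen basis of `V` (the one that identifies `V` with `ℂⁿ`). -/
def sigma {n : ℕ} {V : Type*} [NormedAddCommGroup V] [NormedSpace ℂ V]
    (b : Module.Basis (Fin n) ℂ V)
    {K : Type*} [NormedAddCommGroup K] [InnerProductSpace ℂ K]
    (S : Fin n → (K →L[ℂ] K)) : V →ₗ[ℂ] (K →L[ℂ] K) :=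
  b.constr ℂ S

/-- The value `q(S) = ∑_d c_d S_1^{d_1} ⋯ S_n^{d_n}` of a polynomial at a tuple of elements of an
algebra (used only for commuting tuples). -/
def polyEval {n : ℕ} {A : Type*} [Ring A] [Algebra ℂ A] (S : Fin n → A)
    (q : MvPolynomial (Fin n) ℂ) : A :=
  ∑ d ∈ q.support, q.coeff d • (List.ofFn fun j => S j ^ d j).prod

/-- The norm `‖p(S)‖` of `p(S) = ∑_d A_d ⊗ S^d ∈ M_m ⊗ B(K) = B(K^m)`, for an `m × m` matrix of
polynomials `p = ∑_d A_d z^d`. -/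
def evalNorm {n m : ℕ} (p : Matrix (Fin m) (Fin m) (MvPolynomial (Fin n) ℂ))
    {K : Type*} [NormedAddCommGroup K] [InnerProductSpace ℂ K]
    (S : Fin n → (K →L[ℂ] K)) : ℝ :=
  ‖blockOp (p.map (polyEval S))‖

/-- All the numbers `‖p(S)‖`, for commuting `n`-tuples `S` of bounded operators on some Hilbert space
such that `σ_S` is completely contractive for `E = (V, φ)`. -/
def ucValues {n m : ℕ} {V : Type v} [NormedAddCommGroup V] [NormedSpace ℂ V]
    (b : Module.Basis (Fin n) ℂ V)
    {H : Type w} [NormedAddCommGroup H] [InnerProductSpace ℂ H]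
    (φ : V →ₗᵢ[ℂ] (H →L[ℂ] H))
    (p : Matrix (Fin m) (Fin m) (MvPolynomial (Fin n) ℂ)) : Set ℝ :=
  {r | ∃ (K : Type u) (_ : NormedAddCommGroup K) (_ : InnerProductSpace ℂ K)
      (_ : CompleteSpace K) (S : Fin n → (K →L[ℂ] K)),
      (∀ i j, Commute (S i) (S j)) ∧ IsCompletelyContractive φ (sigma b S) ∧ r = evalNorm p S}

/-- The norm `‖p‖_{UC(E)}`, for `E = (V, φ)`. -/
def ucNorm {n m : ℕ} {V : Type v} [NormedAddCommGroup V] [NormedSpace ℂ V]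
    (b : Module.Basis (Fin n) ℂ V)
    {H : Type w} [NormedAddCommGroup H] [InnerProductSpace ℂ H]
    (φ : V →ₗᵢ[ℂ] (H →L[ℂ] H))
    (p : Matrix (Fin m) (Fin m) (MvPolynomial (Fin n) ℂ)) : ℝ :=
  sSup (ucValues.{u} b φ p)

/-- A tuple of `d × d` matrices as a tuple of operators on the Hilbert space `ℂ^d`. -/
def matrixOps {n d : ℕ} (S : Fin n → Matrix (Fin d) (Fin d) ℂ) :
    Fin n → (EuclideanSpace ℂ (Fin d) →L[ℂ] EuclideanSpace ℂ (Fin d)) :=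
  fun j => Matrix.toEuclideanCLM (𝕜 := ℂ) (S j)

/-- The norm on `M_d(E^*) = CB(E, M_d)` of the dual operator space `E^*` of `E = (V, φ)`, in the
coordinates dual to the basis `b`: the norm of `A = (A_1, …, A_n)` is the supremum of
`‖∑ j, A_j ⊗ B_j‖` over all `l` and all `B = (B_1, …, B_n)` in the unit ball of `M_l(E)`. -/
def dualMatrixNorm {n : ℕ} {V : Type*} [NormedAddCommGroup V] [NormedSpace ℂ V]
    (b : Module.Basis (Fin n) ℂ V)
    {H : Type*} [NormedAddCommGroup H] [InnerProductSpace ℂ H]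
    (φ : V →ₗᵢ[ℂ] (H →L[ℂ] H)) {d : ℕ} (A : Fin n → Matrix (Fin d) (Fin d) ℂ) : ℝ≥0∞ :=
  ⨆ (l : ℕ) (x : Matrix (Fin l) (Fin l) V) (_ : matrixNorm φ x ≤ 1),
    ‖Matrix.toEuclideanCLM (𝕜 := ℂ) (∑ j, A j ⊗ₖ x.map fun y => b.repr y j)‖ₑ

end UC

end

namespace UC

section BlockOp

variable {K : Type*} [NormedAddCommGroup K] [InnerProductSpace ℂ K]
variable {K' : Type*} [NormedAddCommGroup K'] [InnerProductSpace ℂ K']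

theorem norm_blockOp_nonneg {k l : ℕ} (M : Matrix (Fin k) (Fin l) (K →L[ℂ] K)) :
    0 ≤ ‖blockOp M‖ :=
  ContinuousLinearMap.opNorm_nonneg _

theorem norm_blockOp_le_iff {k l : ℕ} (M : Matrix (Fin k) (Fin l) (K →L[ℂ] K)) {C : ℝ}
    (hC : 0 ≤ C) :
    ‖blockOp M‖ ≤ C ↔
      ∀ x : Fin l → K, ∑ i, ‖∑ j, M i j (x j)‖ ^ 2 ≤ C ^ 2 * ∑ j, ‖x j‖ ^ 2 := by
  have key : ∀ x : PiLp 2 (fun _ : Fin l => K), ‖blockOp M x‖ ≤ C * ‖x‖ ↔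
      ∑ i, ‖∑ j, M i j (x j)‖ ^ 2 ≤ C ^ 2 * ∑ j, ‖x j‖ ^ 2 := by
    intro x
    rw [← sq_le_sq₀ (norm_nonneg _) (by positivity), mul_pow, PiLp.norm_sq_eq_of_L2,
      PiLp.norm_sq_eq_of_L2]
    simp only [blockOp_apply]
  rw [ContinuousLinearMap.opNorm_le_iff hC]
  exact ⟨fun h x => (key (WithLp.toLp 2 x)).1 (h _), fun h x => (key x).2 (h _)⟩

theorem sum_sq_le_blockOp {k l : ℕ} (M : Matrix (Fin k) (Fin l) (K →L[ℂ] K)) (x : Fin l → K) :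
    ∑ i, ‖∑ j, M i j (x j)‖ ^ 2 ≤ ‖blockOp M‖ ^ 2 * ∑ j, ‖x j‖ ^ 2 :=
  (norm_blockOp_le_iff M (norm_blockOp_nonneg M)).1 le_rfl x

theorem norm_blockOp_le_of_intertwines {k l : ℕ} {A : Matrix (Fin k) (Fin l) (K' →L[ℂ] K')}
    {B : Matrix (Fin k) (Fin l) (K →L[ℂ] K)} (U : K' →ₗᵢ[ℂ] K)
    (h : ∀ i j y, U (A i j y) = B i j (U y)) : ‖blockOp A‖ ≤ ‖blockOp B‖ := by
  rw [norm_blockOp_le_iff _ (norm_blockOp_nonneg _)]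
  intro x
  have := sum_sq_le_blockOp B fun j => U (x j)
  simpa only [← h, ← map_sum, U.norm_map] using this

theorem norm_entry_le_norm_blockOp {k l : ℕ} (M : Matrix (Fin k) (Fin l) (K →L[ℂ] K))
    (i : Fin k) (j : Fin l) : ‖M i j‖ ≤ ‖blockOp M‖ := by
  refine ContinuousLinearMap.opNorm_le_bound _ (norm_blockOp_nonneg _) fun y => ?_
  have h := sum_sq_le_blockOp M (Pi.single j y)
  have h1 : ∀ i, ∑ j', M i j' ((Pi.single j y : Fin l → K) j') = M i j y := by
    intro i
    rw [Finset.sum_eq_single j] <;> simp +contextual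
  have h2 : ∑ j', ‖(Pi.single j y : Fin l → K) j'‖ ^ 2 = ‖y‖ ^ 2 := by
    rw [Finset.sum_eq_single j] <;> simp +contextual
  simp only [h1, h2, ← mul_pow] at h
  rw [← sq_le_sq₀ (norm_nonneg _) (by positivity)]
  exact (Finset.single_le_sum (f := fun i => ‖M i j y‖ ^ 2) (fun _ _ => sq_nonneg _)
    (Finset.mem_univ i)).trans h

theorem norm_blockOp_le_sum {k l : ℕ} (M : Matrix (Fin k) (Fin l) (K →L[ℂ] K)) :
    ‖blockOp M‖ ≤ ∑ i, ∑ j, ‖M i j‖ := by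
  have h0 : 0 ≤ ∑ i, ∑ j, ‖M i j‖ := by positivity
  refine ContinuousLinearMap.opNorm_le_bound _ h0 fun x => ?_
  have hn : ‖blockOp M x‖ ≤ ∑ i, ‖blockOp M x i‖ := by
    rw [← sq_le_sq₀ (norm_nonneg _) (by positivity), PiLp.norm_sq_eq_of_L2]
    exact Finset.sum_sq_le_sq_sum_of_nonneg fun _ _ => norm_nonneg _
  refine hn.trans ?_
  rw [Finset.sum_mul]
  refine Finset.sum_le_sum fun i _ => ?_
  rw [blockOp_apply, Finset.sum_mul]
  exact norm_sum_le_of_le _ fun j _ => (M i j).le_opNorm_of_le (PiLp.norm_apply_le x j)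

/-- The square matrix with the block `x` in its upper right corner and zeros elsewhere. -/
def squarePad {α : Type*} [Zero α] {k l : ℕ} (x : Matrix (Fin k) (Fin l) α) :
    Matrix (Fin (k + l)) (Fin (k + l)) α :=
  fun i j => Fin.addCases (fun i => Fin.addCases (fun _ => 0) (fun j => x i j) j) (fun _ => 0) i

theorem norm_blockOp_squarePad {k l : ℕ} (M : Matrix (Fin k) (Fin l) (K →L[ℂ] K)) :
    ‖blockOp (squarePad M)‖ = ‖blockOp M‖ := by
  apply le_antisymm
  · rw [norm_blockOp_le_iff _ (norm_blockOp_nonneg _)]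
    intro x
    have h := sum_sq_le_blockOp M fun j => x (Fin.natAdd k j)
    simp only [Fin.sum_univ_add, squarePad, Fin.addCases_left, Fin.addCases_right]
    simp only [_root_.zero_apply, Finset.sum_const_zero, zero_add, norm_zero,
      ne_eq, OfNat.ofNat_ne_zero, not_false_eq_true, zero_pow, add_zero]
    refine h.trans (mul_le_mul_of_nonneg_left ?_ (sq_nonneg _))
    exact le_add_of_nonneg_left (by positivity)
  · rw [norm_blockOp_le_iff _ (norm_blockOp_nonneg _)]
    intro x
    have h := sum_sq_le_blockOp (squarePad M) (Fin.addCases (fun _ => 0) x)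
    simpa [Fin.sum_univ_add, squarePad] using h

theorem squarePad_map {α β : Type*} [Zero α] [Zero β] {k l : ℕ} (x : Matrix (Fin k) (Fin l) α)
    (f : α → β) (hf : f 0 = 0) : (squarePad x).map f = squarePad (x.map f) := by
  ext i j
  refine Fin.addCases (fun i => ?_) (fun i => ?_) i <;>
  refine Fin.addCases (fun j => ?_) (fun j => ?_) j <;> simp [squarePad, hf]

end BlockOp

section Words

/-- The word `1 ⋯ 1 2 ⋯ 2 ⋯ n ⋯ n` in which `j` is repeated `d j` times. -/
def monomialWord {n : ℕ} (d : Fin n →₀ ℕ) : List (Fin n) :=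
  (List.ofFn fun j => List.replicate (d j) j).flatten

theorem monomialWord_map_prod {n : ℕ} {A : Type*} [Monoid A] (S : Fin n → A) (d : Fin n →₀ ℕ) :
    ((monomialWord d).map S).prod = (List.ofFn fun j => S j ^ d j).prod := by
  rw [monomialWord, List.map_flatten, List.prod_flatten, List.map_ofFn, List.map_ofFn]
  congr 2
  ext j
  simp

theorem polyEval_eq_sum_word {n : ℕ} {A : Type*} [Ring A] [Algebra ℂ A] (S : Fin n → A)
    (q : MvPolynomial (Fin n) ℂ) :
    polyEval S q = ∑ d ∈ q.support, q.coeff d • ((monomialWord d).map S).prod := by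
  simp only [polyEval, monomialWord_map_prod]

variable {K : Type*} [NormedAddCommGroup K] [InnerProductSpace ℂ K]
variable {K' : Type*} [NormedAddCommGroup K'] [InnerProductSpace ℂ K'] {n : ℕ}

theorem word_intertwines {T : Fin n → K' →L[ℂ] K'} {S : Fin n → K →L[ℂ] K} (U : K' →ₗᵢ[ℂ] K)
    (h : ∀ j y, U (T j y) = S j (U y)) (w : List (Fin n)) (y : K') :
    U ((w.map T).prod y) = (w.map S).prod (U y) := by
  induction w with
  | nil => simp
  | cons j w ih => simp [h, ih]

theorem polyEval_intertwines {T : Fin n → K' →L[ℂ] K'} {S : Fin n → K →L[ℂ] K} (U : K' →ₗᵢ[ℂ] K)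
    (h : ∀ j y, U (T j y) = S j (U y)) (q : MvPolynomial (Fin n) ℂ) (y : K') :
    U (polyEval T q y) = polyEval S q (U y) := by
  simp [polyEval_eq_sum_word, word_intertwines U h]

theorem commute_of_intertwines {T : Fin n → K' →L[ℂ] K'} {S : Fin n → K →L[ℂ] K}
    (U : K' →ₗᵢ[ℂ] K) (h : ∀ j y, U (T j y) = S j (U y)) (hS : ∀ i j, Commute (S i) (S j))
    (i j : Fin n) : Commute (T i) (T j) := by
  ext y
  apply U.injective
  simpa [h] using congr($(hS i j) (U y))

theorem norm_word_le {S : Fin n → K →L[ℂ] K} {C : Fin n → ℝ} (h : ∀ j, ‖S j‖ ≤ C j)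
    (w : List (Fin n)) : ‖(w.map S).prod‖ ≤ (w.map C).prod := by
  induction w with
  | nil => exact ContinuousLinearMap.norm_id_le
  | cons j w ih =>
    simp only [List.map_cons, List.prod_cons]
    exact (norm_mul_le _ _).trans
      (mul_le_mul (h j) ih (norm_nonneg _) ((norm_nonneg _).trans (h j)))

theorem norm_polyEval_le {S : Fin n → K →L[ℂ] K} {C : Fin n → ℝ} (h : ∀ j, ‖S j‖ ≤ C j)
    (q : MvPolynomial (Fin n) ℂ) :
    ‖polyEval S q‖ ≤ ∑ d ∈ q.support, ‖q.coeff d‖ * ((monomialWord d).map C).prod := by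
  rw [polyEval_eq_sum_word]
  refine norm_sum_le_of_le _ fun d _ => ?_
  rw [norm_smul]
  exact mul_le_mul_of_nonneg_left (norm_word_le h _) (norm_nonneg _)

end Words

section Sigma

variable {n : ℕ} {V : Type*} [NormedAddCommGroup V] [NormedSpace ℂ V] (b : Module.Basis (Fin n) ℂ V)
variable {H : Type*} [NormedAddCommGroup H] [InnerProductSpace ℂ H] {φ : V →ₗᵢ[ℂ] (H →L[ℂ] H)}
variable {K : Type*} [NormedAddCommGroup K] [InnerProductSpace ℂ K]
variable {K' : Type*} [NormedAddCommGroup K'] [InnerProductSpace ℂ K']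

theorem sigma_apply (S : Fin n → (K →L[ℂ] K)) (v : V) : sigma b S v = ∑ j, b.repr v j • S j := by
  simp [sigma, Module.Basis.constr_apply_fintype]

theorem sigma_intertwines {T : Fin n → K' →L[ℂ] K'} {S : Fin n → K →L[ℂ] K} (U : K' →ₗᵢ[ℂ] K)
    (h : ∀ j y, U (T j y) = S j (U y)) (v : V) (y : K') :
    U (sigma b T v y) = sigma b S v (U y) := by
  simp [sigma_apply, h]

variable {b}

theorem IsCompletelyContractive.of_intertwines {T : Fin n → K' →L[ℂ] K'} {S : Fin n → K →L[ℂ] K}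
    (hS : IsCompletelyContractive φ (sigma b S)) (U : K' →ₗᵢ[ℂ] K)
    (h : ∀ j y, U (T j y) = S j (U y)) : IsCompletelyContractive φ (sigma b T) := fun k l x =>
  (norm_blockOp_le_of_intertwines U fun _ _ y => sigma_intertwines b U h _ y).trans (hS k l x)

theorem evalNorm_le_of_intertwines {m : ℕ} (p : Matrix (Fin m) (Fin m) (MvPolynomial (Fin n) ℂ))
    {T : Fin n → K' →L[ℂ] K'} {S : Fin n → K →L[ℂ] K} (U : K' →ₗᵢ[ℂ] K)
    (h : ∀ j y, U (T j y) = S j (U y)) : evalNorm p T ≤ evalNorm p S :=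
  norm_blockOp_le_of_intertwines U fun _ _ y => polyEval_intertwines U h _ y

theorem exists_evalNorm_le (b : Module.Basis (Fin n) ℂ V) (φ : V →ₗᵢ[ℂ] (H →L[ℂ] H))
    {m : ℕ} (p : Matrix (Fin m) (Fin m) (MvPolynomial (Fin n) ℂ)) :
    ∃ C : ℝ, ∀ (K : Type u) [NormedAddCommGroup K] [InnerProductSpace ℂ K]
      (S : Fin n → (K →L[ℂ] K)), IsCompletelyContractive φ (sigma b S) → evalNorm p S ≤ C := by
  let c : Fin n → ℝ := fun j => matrixNorm φ (Matrix.of fun _ _ : Fin 1 => b j)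
  refine ⟨∑ i, ∑ j, ∑ d ∈ (p i j).support, ‖(p i j).coeff d‖ * ((monomialWord d).map c).prod,
    fun K _ _ S hS => ?_⟩
  have hc : ∀ j, ‖S j‖ ≤ c j := fun j => by
    refine le_trans ?_ (hS 1 1 (Matrix.of fun _ _ => b j))
    refine le_trans (le_of_eq ?_) (norm_entry_le_norm_blockOp _ 0 0)
    rw [Matrix.map_apply, Matrix.of_apply, sigma, Module.Basis.constr_basis]
  refine (norm_blockOp_le_sum _).trans ?_
  exact Finset.sum_le_sum fun i _ => Finset.sum_le_sum fun j _ => norm_polyEval_le hc _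

end Sigma

section Shift

variable {K : Type*} [NormedAddCommGroup K] [InnerProductSpace ℂ K]

/-- The tensor product of an operator on `K` with the truncated shift of size `M`. -/
def shiftOp (M : ℕ) : (K →L[ℂ] K) →
    (PiLp 2 (fun _ : Fin M => K) →L[ℂ] PiLp 2 (fun _ : Fin M => K)) := fun T =>
  blockOp <| Matrix.of fun i i' => if (i : ℕ) = i' + 1 then T else 0

theorem shiftOp_apply_succ {M : ℕ} (T : K →L[ℂ] K) (x : PiLp 2 (fun _ : Fin (M + 1) => K))
    (i : Fin M) : shiftOp (M + 1) T x i.succ = T (x i.castSucc) := by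
  rw [shiftOp, blockOp_apply, Finset.sum_eq_single i.castSucc]
  · simp
  · intro j _ hj
    rw [Matrix.of_apply, if_neg, _root_.zero_apply]
    simp only [Fin.val_succ, Nat.add_right_cancel_iff]
    exact fun h => hj (Fin.ext h.symm)
  · simp

theorem shiftOp_apply_zero {M : ℕ} (T : K →L[ℂ] K) (x : PiLp 2 (fun _ : Fin (M + 1) => K)) :
    shiftOp (M + 1) T x 0 = 0 := by
  rw [shiftOp, blockOp_apply]
  simp

theorem commute_shiftOp {M : ℕ} {T T' : K →L[ℂ] K} (h : Commute T T') :
    Commute (shiftOp (M + 1) T) (shiftOp (M + 1) T') := by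
  ext x i
  change shiftOp (M + 1) T (shiftOp (M + 1) T' x) i = shiftOp (M + 1) T' (shiftOp (M + 1) T x) i
  refine Fin.cases ?_ (fun i => ?_) i
  · simp only [shiftOp_apply_zero]
  · simp only [shiftOp_apply_succ]
    obtain _ | M := M
    · exact i.elim0
    refine Fin.cases ?_ (fun i => ?_) i
    · simp only [Fin.castSucc_zero, shiftOp_apply_zero, map_zero]
    · simp only [← Fin.succ_castSucc, shiftOp_apply_succ]
      exact congr($h _)

variable {n : ℕ}

theorem shiftOp_word_apply_of_lt {M : ℕ} (S : Fin n → K →L[ℂ] K) (w : List (Fin n))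
    (x : PiLp 2 (fun _ : Fin (M + 1) => K)) (i : Fin (M + 1)) (hi : (i : ℕ) < w.length) :
    (w.map fun j => shiftOp (M + 1) (S j)).prod x i = 0 := by
  induction w generalizing i with
  | nil => simp at hi
  | cons j w ih =>
    simp only [List.map_cons, List.prod_cons, mul_apply_eq_comp]
    revert hi
    refine Fin.cases (fun _ => shiftOp_apply_zero _ _) (fun i hi => ?_) i
    rw [shiftOp_apply_succ, ih _ (by simpa using hi), map_zero]

theorem shiftOp_word_apply_const {M : ℕ} (S : Fin n → K →L[ℂ] K) (w : List (Fin n))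
    (h : K) (i : Fin (M + 1)) (hi : w.length ≤ i) :
    (w.map fun j => shiftOp (M + 1) (S j)).prod (WithLp.toLp 2 fun _ => h) i =
      (w.map S).prod h := by
  induction w generalizing i with
  | nil => simp
  | cons j w ih =>
    simp only [List.map_cons, List.prod_cons, mul_apply_eq_comp]
    revert hi
    refine Fin.cases (fun hi => by simp at hi) (fun i hi => ?_) i
    rw [shiftOp_apply_succ, ih _ (by simpa using hi)]

theorem shiftOp_polyEval_apply_const {M : ℕ} (S : Fin n → K →L[ℂ] K)
    (q : MvPolynomial (Fin n) ℂ) (h : K) (i : Fin (M + 1))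
    (hi : ∀ d ∈ q.support, (monomialWord d).length ≤ i) :
    polyEval (fun j => shiftOp (M + 1) (S j)) q (WithLp.toLp 2 fun _ => h) i =
      polyEval S q h := by
  simp only [polyEval_eq_sum_word, _root_.sum_apply, WithLp.ofLp_sum,
    Finset.sum_apply, _root_.smul_apply, PiLp.smul_apply]
  exact Finset.sum_congr rfl fun d hd => by rw [shiftOp_word_apply_const _ _ _ _ (hi d hd)]

variable {V : Type*} [NormedAddCommGroup V] [NormedSpace ℂ V] {b : Module.Basis (Fin n) ℂ V}
variable {H : Type*} [NormedAddCommGroup H] [InnerProductSpace ℂ H] {φ : V →ₗᵢ[ℂ] (H →L[ℂ] H)}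

theorem sigma_shiftOp {M : ℕ} (S : Fin n → K →L[ℂ] K) (v : V) :
    sigma b (fun j => shiftOp (M + 1) (S j)) v = shiftOp (M + 1) (sigma b S v) := by
  ext x i
  simp only [sigma_apply, _root_.sum_apply, WithLp.ofLp_sum,
    Finset.sum_apply, _root_.smul_apply, PiLp.smul_apply]
  refine Fin.cases ?_ (fun i => ?_) i
  · simp only [shiftOp_apply_zero, smul_zero, Finset.sum_const_zero]
  · simp only [shiftOp_apply_succ, _root_.sum_apply, _root_.smul_apply]

theorem norm_blockOp_shiftOp_le {M k l : ℕ} (A : Matrix (Fin k) (Fin l) (K →L[ℂ] K)) :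
    ‖blockOp (A.map (shiftOp (M + 1)))‖ ≤ ‖blockOp A‖ := by
  rw [norm_blockOp_le_iff _ (norm_blockOp_nonneg _)]
  intro x
  simp only [PiLp.norm_sq_eq_of_L2, WithLp.ofLp_sum, Finset.sum_apply, Matrix.map_apply]
  rw [Finset.sum_comm, Finset.sum_comm (s := Finset.univ (α := Fin l)), Fin.sum_univ_succ]
  simp only [shiftOp_apply_zero, shiftOp_apply_succ, Finset.sum_const_zero, norm_zero, ne_eq,
    OfNat.ofNat_ne_zero, not_false_eq_true, zero_pow, zero_add]
  rw [Fin.sum_univ_castSucc, mul_add, Finset.mul_sum]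
  exact le_add_of_le_of_nonneg
    (Finset.sum_le_sum fun i _ => sum_sq_le_blockOp A fun j => x j i.castSucc) (by positivity)

theorem IsCompletelyContractive.shiftOp {S : Fin n → K →L[ℂ] K}
    (hS : IsCompletelyContractive φ (sigma b S)) (M : ℕ) :
    IsCompletelyContractive φ (sigma b fun j => shiftOp (M + 1) (S j)) := by
  intro k l x
  refine le_trans (le_of_eq ?_)
    ((norm_blockOp_shiftOp_le (M := M) (x.map (sigma b S))).trans (hS k l x))
  congr 2
  ext1 i j
  exact sigma_shiftOp S (x i j)

end Shift

section FiniteDimensional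

variable {K : Type*} [NormedAddCommGroup K] [InnerProductSpace ℂ K] {n : ℕ}

/-- If all sufficiently long words in `N` vanish, then finitely many vectors lie in a
finite-dimensional invariant subspace of `N`, here given as the range of an isometry. -/
theorem exists_matrix_intertwines (N : Fin n → K →L[ℂ] K) (M : ℕ)
    (hN : ∀ w : List (Fin n), M ≤ w.length → (w.map N).prod = 0) {m : ℕ} (h : Fin m → K) :
    ∃ (d : ℕ) (S : Fin n → Matrix (Fin d) (Fin d) ℂ) (U : EuclideanSpace ℂ (Fin d) →ₗᵢ[ℂ] K),
      (∀ j y, U (matrixOps S j y) = N j (U y)) ∧ ∀ i, ∃ y, U y = h i := by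
  let X : Set K := Set.image2 (fun (w : List (Fin n)) i => (w.map N).prod (h i))
    {w | w.length < M + 1} Set.univ
  have hX : X.Finite := (List.finite_length_lt _ _).image2 _ Set.finite_univ
  let L : Submodule ℂ K := Submodule.span ℂ X
  have : FiniteDimensional ℂ L := FiniteDimensional.span_of_finite ℂ hX
  have hL : ∀ j, ∀ y ∈ L, N j y ∈ L := by
    intro j y hy
    have : L ≤ L.comap (N j : K →ₗ[ℂ] K) := by
      refine Submodule.span_le.2 ?_
      rintro _ ⟨w, hw, i, -, rfl⟩
      have e : N j ((w.map N).prod (h i)) = ((j :: w).map N).prod (h i) := by simp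
      change N j ((w.map N).prod (h i)) ∈ L
      rw [e]
      rcases lt_or_ge (j :: w).length (M + 1) with h1 | h1
      · exact Submodule.subset_span ⟨_, h1, i, trivial, rfl⟩
      · rw [hN _ (by omega)]
        exact L.zero_mem
    exact this hy
  let e := (stdOrthonormalBasis ℂ L).repr
  let T : Fin n → (EuclideanSpace ℂ (Fin (Module.finrank ℂ L)) →L[ℂ]
      EuclideanSpace ℂ (Fin (Module.finrank ℂ L))) := fun j =>
    LinearMap.toContinuousLinearMap
      (e.toLinearEquiv.toLinearMap ∘ₗ ((N j : K →ₗ[ℂ] K).restrict (hL j)) ∘ₗ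
        e.symm.toLinearEquiv.toLinearMap)
  refine ⟨Module.finrank ℂ L, fun j => (Matrix.toEuclideanCLM (𝕜 := ℂ)).symm (T j),
    L.subtypeₗᵢ.comp e.symm.toLinearIsometry, fun j y => ?_, fun i => ?_⟩
  · simp [matrixOps, T]
  · have hi : h i ∈ L := Submodule.subset_span ⟨[], by simp, i, trivial, by simp⟩
    exact ⟨e ⟨h i, hi⟩, by simp⟩

variable {V : Type*} [NormedAddCommGroup V] [NormedSpace ℂ V] {b : Module.Basis (Fin n) ℂ V}
variable {H : Type*} [NormedAddCommGroup H] [InnerProductSpace ℂ H] {φ : V →ₗᵢ[ℂ] (H →L[ℂ] H)}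

theorem evalNorm_le_of_forall_matrix {m : ℕ}
    (p : Matrix (Fin m) (Fin m) (MvPolynomial (Fin n) ℂ)) {B : ℝ} (hB : 0 ≤ B)
    (hmat : ∀ (d : ℕ) (S : Fin n → Matrix (Fin d) (Fin d) ℂ), (∀ i j, Commute (S i) (S j)) →
      IsCompletelyContractive φ (sigma b (matrixOps S)) → evalNorm p (matrixOps S) ≤ B)
    {S : Fin n → K →L[ℂ] K} (hS : ∀ i j, Commute (S i) (S j))
    (hcc : IsCompletelyContractive φ (sigma b S)) : evalNorm p S ≤ B := by
  obtain ⟨D, hD⟩ : ∃ D : ℕ, ∀ i j, ∀ d ∈ (p i j).support, (monomialWord d).length ≤ D := by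
    refine ⟨∑ i, ∑ j, ∑ d ∈ (p i j).support, (monomialWord d).length, fun i j d hd => ?_⟩
    calc (monomialWord d).length ≤ ∑ d ∈ (p i j).support, (monomialWord d).length :=
          Finset.single_le_sum (f := fun d => (monomialWord d).length)
            (fun _ _ => Nat.zero_le _) hd
      _ ≤ ∑ j, ∑ d ∈ (p i j).support, (monomialWord d).length :=
          Finset.single_le_sum (f := fun j => ∑ d ∈ (p i j).support, (monomialWord d).length)
            (fun _ _ => Nat.zero_le _) (Finset.mem_univ j)
      _ ≤ _ := Finset.single_le_sum
            (f := fun i => ∑ j, ∑ d ∈ (p i j).support, (monomialWord d).length)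
            (fun _ _ => Nat.zero_le _) (Finset.mem_univ i)
  rw [evalNorm, norm_blockOp_le_iff _ hB]
  intro h
  set α := ∑ i, ‖∑ j, p.map (polyEval S) i j (h j)‖ ^ 2 with hα
  set β := B ^ 2 * ∑ j, ‖h j‖ ^ 2 with hβ
  have key : ∀ M : ℕ, ((M : ℝ) + 1) * α ≤ (D + M + 1) * β := by
    intro M
    let N : Fin n → _ := fun j => shiftOp (K := K) (D + M + 1) (S j)
    let g : Fin m → PiLp 2 (fun _ : Fin (D + M + 1) => K) := fun i => WithLp.toLp 2 fun _ => h i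
    obtain ⟨d, T, U, hU, hg⟩ := exists_matrix_intertwines N (D + M + 1)
      (fun w hw => by
        ext x i
        exact shiftOp_word_apply_of_lt S w x i (i.2.trans_le hw)) g
    choose y hy using hg
    have hTN : ∀ i j, Commute (T i) (T j) := fun i j => by
      have := commute_of_intertwines U hU (fun i j => commute_shiftOp (hS i j)) i j
      exact (commute_map_iff (Matrix.toEuclideanCLM (𝕜 := ℂ)).injective).1 this
    have h1 := hmat d T hTN ((hcc.shiftOp (D + M)).of_intertwines U hU)
    rw [evalNorm, norm_blockOp_le_iff _ hB] at h1
    have h2 := h1 y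
    have h3 : ∑ j, ‖y j‖ ^ 2 = (D + M + 1) * ∑ j, ‖h j‖ ^ 2 := by
      rw [Finset.mul_sum]
      refine Finset.sum_congr rfl fun j _ => ?_
      rw [← U.norm_map, hy, PiLp.norm_sq_eq_of_L2]
      simp [g]
    have h4 : ((M : ℝ) + 1) * α ≤
        ∑ i, ‖∑ j, p.map (polyEval (matrixOps T)) i j (y j)‖ ^ 2 := by
      rw [hα, Finset.mul_sum]
      refine Finset.sum_le_sum fun i _ => ?_
      rw [← U.norm_map, PiLp.norm_sq_eq_of_L2, map_sum]
      simp only [Matrix.map_apply, polyEval_intertwines U hU, hy, WithLp.ofLp_sum,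
        Finset.sum_apply]
      have h5 : ∀ t : Fin (D + (M + 1)), D ≤ (t : ℕ) →
          ‖∑ j, polyEval N (p i j) (g j) t‖ ^ 2 = ‖∑ j, polyEval S (p i j) (h j)‖ ^ 2 := by
        intro t ht
        congr 2
        exact Finset.sum_congr rfl fun j _ =>
          shiftOp_polyEval_apply_const S _ _ _ fun d hd => (hD i j d hd).trans ht
      change _ ≤ ∑ t : Fin (D + (M + 1)), ‖∑ j, polyEval N (p i j) (g j) t‖ ^ 2
      rw [Fin.sum_univ_add]
      refine le_add_of_nonneg_of_le (by positivity) ?_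
      rw [Finset.sum_congr rfl fun t _ => h5 (Fin.natAdd D t) (by simp)]
      simp
    calc ((M : ℝ) + 1) * α ≤ _ := h4
      _ ≤ _ := h2
      _ = _ := by rw [h3, hβ]; ring
  by_contra! hlt
  obtain ⟨M, hM⟩ := exists_nat_gt (D * β / (α - β))
  rw [div_lt_iff₀ (sub_pos.2 hlt)] at hM
  have := key M
  nlinarith

end FiniteDimensional

section Dual

theorem norm_toEuclideanCLM_le_iff {ι : Type*} [Fintype ι] [DecidableEq ι] (A : Matrix ι ι ℂ)
    {C : ℝ} (hC : 0 ≤ C) : ‖Matrix.toEuclideanCLM (𝕜 := ℂ) A‖ ≤ C ↔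
      ∀ x : ι → ℂ, ∑ i, ‖∑ j, A i j * x j‖ ^ 2 ≤ C ^ 2 * ∑ j, ‖x j‖ ^ 2 := by
  have key : ∀ x : EuclideanSpace ℂ ι, ‖Matrix.toEuclideanCLM (𝕜 := ℂ) A x‖ ≤ C * ‖x‖ ↔
      ∑ i, ‖∑ j, A i j * x j‖ ^ 2 ≤ C ^ 2 * ∑ j, ‖x j‖ ^ 2 := by
    intro x
    rw [← sq_le_sq₀ (norm_nonneg _) (by positivity), mul_pow, PiLp.norm_sq_eq_of_L2,
      PiLp.norm_sq_eq_of_L2]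
    simp [Matrix.mulVec, dotProduct]
  rw [ContinuousLinearMap.opNorm_le_iff hC]
  exact ⟨fun h x => (key (WithLp.toLp 2 x)).1 (h _), fun h x => (key x).2 (h _)⟩

variable {n d : ℕ} {V : Type*} [NormedAddCommGroup V] [NormedSpace ℂ V]
variable (b : Module.Basis (Fin n) ℂ V)

theorem norm_toEuclideanCLM_sum_kronecker {l : ℕ} (S : Fin n → Matrix (Fin d) (Fin d) ℂ)
    (x : Matrix (Fin l) (Fin l) V) :
    ‖Matrix.toEuclideanCLM (𝕜 := ℂ) (∑ j, S j ⊗ₖ x.map fun y => b.repr y j)‖ =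
      ‖blockOp (x.map (sigma b (matrixOps S)))‖ := by
  refine eq_of_forall_ge_iff fun C => ?_
  by_cases hC : 0 ≤ C
  swap
  · exact iff_of_false (fun h => hC ((norm_nonneg _).trans h))
      fun h => hC ((norm_nonneg _).trans h)
  rw [norm_toEuclideanCLM_le_iff _ hC, norm_blockOp_le_iff _ hC]
  have key : ∀ y : Fin d × Fin l → ℂ,
      (∑ i, ‖∑ j, (∑ s, S s ⊗ₖ x.map fun y => b.repr y s) i j * y j‖ ^ 2 ≤
        C ^ 2 * ∑ j, ‖y j‖ ^ 2) ↔
      (∑ i, ‖∑ j, x.map (sigma b (matrixOps S)) i j (WithLp.toLp 2 fun t => y (t, j))‖ ^ 2 ≤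
        C ^ 2 * ∑ j, ‖(WithLp.toLp 2 fun t => y (t, j) : EuclideanSpace ℂ (Fin d))‖ ^ 2) := by
    intro y
    simp only [PiLp.norm_sq_eq_of_L2, Fintype.sum_prod_type_right, Matrix.sum_apply,
      Matrix.kroneckerMap_apply, Matrix.map_apply, sigma_apply, WithLp.ofLp_sum,
      Finset.sum_apply, _root_.sum_apply, _root_.smul_apply,
      PiLp.smul_apply, smul_eq_mul, matrixOps, Matrix.ofLp_toEuclideanCLM, Matrix.mulVec,
      dotProduct, Finset.mul_sum, Finset.sum_mul]
    refine iff_of_eq (congrArg (· ≤ _) ?_)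
    refine Finset.sum_congr rfl fun i _ => Finset.sum_congr rfl fun t _ => ?_
    congr 2
    refine Finset.sum_congr rfl fun j _ => ?_
    rw [Finset.sum_comm]
    exact Finset.sum_congr rfl fun s _ => Finset.sum_congr rfl fun t' _ => by ring
  exact ⟨fun h y => (key fun q => y q.2 q.1).1 (h _), fun h y => (key y).2 (h _)⟩

variable {H : Type*} [NormedAddCommGroup H] [InnerProductSpace ℂ H] (φ : V →ₗᵢ[ℂ] (H →L[ℂ] H))
variable {K : Type*} [NormedAddCommGroup K] [InnerProductSpace ℂ K]

theorem norm_smul_continuousLinearMap {E F : Type*} [SeminormedAddCommGroup E]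
    [NormedSpace ℂ E] [SeminormedAddCommGroup F] [NormedSpace ℂ F] (c : ℂ) (T : E →L[ℂ] F) :
    ‖c • T‖ = ‖c‖ * ‖T‖ :=
  norm_smul c T

theorem norm_blockOp_map_smul {k l : ℕ} (ψ : V →ₗ[ℂ] (K →L[ℂ] K)) (c : ℂ)
    (x : Matrix (Fin k) (Fin l) V) :
    ‖blockOp ((c • x).map ψ)‖ = ‖c‖ * ‖blockOp (x.map ψ)‖ := by
  refine Eq.trans ?_ (norm_smul_continuousLinearMap c (blockOp (x.map ψ)))
  congr 1
  ext y i
  simp [blockOp_apply, Finset.smul_sum]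

variable {φ} in
/-- It is enough to test complete contractivity on the unit balls of square matrices. -/
theorem isCompletelyContractive_iff (ψ : V →ₗ[ℂ] (K →L[ℂ] K)) :
    IsCompletelyContractive φ ψ ↔ ∀ (l : ℕ) (x : Matrix (Fin l) (Fin l) V),
      matrixNorm φ x ≤ 1 → ‖blockOp (x.map ψ)‖ ≤ 1 := by
  refine ⟨fun h l x hx => (h l l x).trans hx, fun h => ?_⟩
  have hsq : ∀ (l : ℕ) (x : Matrix (Fin l) (Fin l) V),
      ‖blockOp (x.map ψ)‖ ≤ matrixNorm φ x := by
    intro l x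
    refine le_of_forall_gt_imp_ge_of_dense fun c hc => ?_
    have hc0 : 0 < c := (norm_blockOp_nonneg _).trans_lt hc
    have hn : ‖((c⁻¹ : ℝ) : ℂ)‖ = c⁻¹ := by
      rw [Complex.norm_real, Real.norm_of_nonneg (by positivity)]
    have h1 : matrixNorm φ (((c⁻¹ : ℝ) : ℂ) • x) ≤ 1 := by
      have := norm_blockOp_map_smul φ.toLinearMap ((c⁻¹ : ℝ) : ℂ) x
      rw [hn] at this
      refine this.le.trans ?_
      rw [inv_mul_le_iff₀ hc0, mul_one]
      exact hc.le
    have h2 := h l _ h1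
    rwa [norm_blockOp_map_smul, hn, inv_mul_le_iff₀ hc0, mul_one] at h2
  intro k l x
  have h1 := hsq _ (squarePad x)
  rwa [matrixNorm, squarePad_map _ _ (map_zero _), squarePad_map _ _ (map_zero _),
    norm_blockOp_squarePad, norm_blockOp_squarePad] at h1

theorem isCompletelyContractive_sigma_matrixOps_iff (S : Fin n → Matrix (Fin d) (Fin d) ℂ) :
    IsCompletelyContractive φ (sigma b (matrixOps S)) ↔ dualMatrixNorm b φ S ≤ 1 := by
  rw [isCompletelyContractive_iff, dualMatrixNorm]
  simp only [iSup_le_iff, ← norm_toEuclideanCLM_sum_kronecker, ← ofReal_norm,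
    ENNReal.ofReal_le_one]

end Dual

section Universe

variable {n d : ℕ}

/-- A matrix tuple acts on the copy of `ℂ^d` in an arbitrary universe. -/
theorem exists_ulift_matrixOps (S : Fin n → Matrix (Fin d) (Fin d) ℂ) :
    ∃ (T : Fin n → (EuclideanSpace ℂ (ULift.{u} (Fin d)) →L[ℂ]
        EuclideanSpace ℂ (ULift.{u} (Fin d))))
      (U : EuclideanSpace ℂ (ULift.{u} (Fin d)) ≃ₗᵢ[ℂ] EuclideanSpace ℂ (Fin d)),
      ∀ j y, U (T j y) = matrixOps S j (U y) := by
  let U : EuclideanSpace ℂ (ULift.{u} (Fin d)) ≃ₗᵢ[ℂ] EuclideanSpace ℂ (Fin d) :=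
    LinearIsometryEquiv.piLpCongrLeft 2 ℂ ℂ Equiv.ulift
  exact ⟨fun j => U.symm.toContinuousLinearEquiv.toContinuousLinearMap ∘L matrixOps S j ∘L
    U.toContinuousLinearEquiv.toContinuousLinearMap, U, fun j y => by simp⟩

end Universe

theorem evalNorm_matrixOps_mem_ucValues {n m d : ℕ} {V : Type v} [NormedAddCommGroup V]
    [NormedSpace ℂ V] {b : Module.Basis (Fin n) ℂ V} {H : Type w} [NormedAddCommGroup H]
    [InnerProductSpace ℂ H] {φ : V →ₗᵢ[ℂ] (H →L[ℂ] H)}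
    (p : Matrix (Fin m) (Fin m) (MvPolynomial (Fin n) ℂ)) {S : Fin n → Matrix (Fin d) (Fin d) ℂ}
    (hS : ∀ i j, Commute (S i) (S j)) (hcc : IsCompletelyContractive φ (sigma b (matrixOps S))) :
    evalNorm p (matrixOps S) ∈ ucValues.{u} b φ p := by
  obtain ⟨T, U, h⟩ := exists_ulift_matrixOps.{u} S
  have h' : ∀ j y, U.symm.toLinearIsometry (matrixOps S j y) =
      T j (U.symm.toLinearIsometry y) := fun j y => by
    apply U.injective
    simp [h]
  refine ⟨_, inferInstance, inferInstance, inferInstance, T,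
    commute_of_intertwines U.toLinearIsometry h
      fun i j => (hS i j).map (Matrix.toEuclideanCLM (𝕜 := ℂ)),
    hcc.of_intertwines U.toLinearIsometry h, le_antisymm ?_ ?_⟩
  · exact evalNorm_le_of_intertwines p U.symm.toLinearIsometry h'
  · exact evalNorm_le_of_intertwines p U.toLinearIsometry h

end UC

theorem mainTheorem3 {n : ℕ}
    {V : Type v} [NormedAddCommGroup V] [NormedSpace ℂ V] (b : Module.Basis (Fin n) ℂ V)
    {H : Type w} [NormedAddCommGroup H] [InnerProductSpace ℂ H] [CompleteSpace H]
    (φ : V →ₗᵢ[ℂ] (H →L[ℂ] H))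
    {m : ℕ} (p : Matrix (Fin m) (Fin m) (MvPolynomial (Fin n) ℂ)) :
    IsLUB (UC.ucValues.{u} b φ p) (UC.ucNorm.{u} b φ p) ∧
    IsLUB {r : ℝ | ∃ (d : ℕ) (S : Fin n → Matrix (Fin d) (Fin d) ℂ),
        (∀ i j, Commute (S i) (S j)) ∧
        UC.IsCompletelyContractive φ (UC.sigma b (UC.matrixOps S)) ∧
        r = UC.evalNorm p (UC.matrixOps S)} (UC.ucNorm.{u} b φ p) ∧
    IsLUB {r : ℝ | ∃ (d : ℕ) (S : Fin n → Matrix (Fin d) (Fin d) ℂ),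
        (∀ i j, Commute (S i) (S j)) ∧
        UC.dualMatrixNorm b φ S ≤ 1 ∧
        r = UC.evalNorm p (UC.matrixOps S)} (UC.ucNorm.{u} b φ p) ∧
    ∀ (d : ℕ) (S : Fin n → Matrix (Fin d) (Fin d) ℂ),
      UC.IsCompletelyContractive φ (UC.sigma b (UC.matrixOps S)) ↔ UC.dualMatrixNorm b φ S ≤ 1 := by
  have h4 := fun (d : ℕ) (S : Fin n → Matrix (Fin d) (Fin d) ℂ) =>
    UC.isCompletelyContractive_sigma_matrixOps_iff b φ S
  have hzero : UC.IsCompletelyContractive φ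
      (UC.sigma b (UC.matrixOps fun _ => (0 : Matrix (Fin 0) (Fin 0) ℂ))) := by
    intro k l x
    refine le_trans ((UC.norm_blockOp_le_iff _ le_rfl).2 fun y => ?_) (UC.norm_blockOp_nonneg _)
    simp [Subsingleton.elim _ (0 : EuclideanSpace ℂ (Fin 0))]
  have hzc : ∀ i j : Fin n, Commute ((fun _ => 0 : Fin n → Matrix (Fin 0) (Fin 0) ℂ) i)
      ((fun _ => 0 : Fin n → Matrix (Fin 0) (Fin 0) ℂ) j) := fun _ _ => Commute.refl _
  obtain ⟨C, hC⟩ := UC.exists_evalNorm_le.{u} b φ p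
  have h1 : IsLUB (UC.ucValues.{u} b φ p) (UC.ucNorm.{u} b φ p) := by
    refine isLUB_csSup ⟨_, UC.evalNorm_matrixOps_mem_ucValues p hzc hzero⟩ ⟨C, ?_⟩
    rintro _ ⟨K, _, _, _, S, -, hcc, rfl⟩
    exact hC K S hcc
  have h2 : IsLUB {r : ℝ | ∃ (d : ℕ) (S : Fin n → Matrix (Fin d) (Fin d) ℂ),
        (∀ i j, Commute (S i) (S j)) ∧
        UC.IsCompletelyContractive φ (UC.sigma b (UC.matrixOps S)) ∧
        r = UC.evalNorm p (UC.matrixOps S)} (UC.ucNorm.{u} b φ p) := by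
    refine ⟨?_, fun B hB => h1.2 ?_⟩
    · rintro _ ⟨d, S, hS, hcc, rfl⟩
      exact h1.1 (UC.evalNorm_matrixOps_mem_ucValues p hS hcc)
    · rintro _ ⟨K, _, _, _, S, hS, hcc, rfl⟩
      exact UC.evalNorm_le_of_forall_matrix p
        ((norm_nonneg _).trans (hB ⟨_, _, hzc, hzero, rfl⟩))
        (fun d T hT hT' => hB ⟨d, T, hT, hT', rfl⟩) hS hcc
  refine ⟨h1, h2, ?_, h4⟩
  simpa only [h4] using h2
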